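/- Let $N\ge 1$ be an integer, let $p,q>N-1$ be real, and let $A_N=\{x\in\mathbb R^N:\ -1\le x_1\le\dots\le x_N\le 1\}$. Consider the ODE $$\frac{d}{dt}x_i(t)=(p-q)-(p+q)x_i(t)+2\sum_{j\ne i}\frac{1-x_i(t)x_j(t)}{x_i(t)-x_j(t)}\quad(i=1,\dots,N),\qquad x(0)=x_0. \tag{1}$$ A solution of (1) on $[0,\infty)$ is a continuous function $x:[0,\infty)\to\mathbb R^N$ with $x(0)=x_0$ such that, for all $t>0$, the coordinates of $x(t)$ are pairwise distinct and the differential equation holds at $t$. Let $P_N^{(\alpha,\beta)}$ be the Jacobi polynomial $$P_N^{(\alpha,\beta)}(x)=\frac1{N!}\sum_{k=0}^N\binom Nk (N+\alpha+\beta+1)_k\,(\alpha+k+1)_{N-k}\Bigl(\frac{x-1}2\Bigr)^k,\qquad (a)_k=a(a+1)\cdots(a+k-1),$$ that is, the polynomial of degree $N$, in the classical normalization, of the family that for $\alpha,\beta>-1$ is orthogonal on $(-1,1)$ with respect to the weight $(1-x)^\alpha(1+x)^\beta$. Then $P_N^{(q-N,p-N)}$ has $N$ simple real zeros $z_1<\dots<z_N$,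 the vector $z=(z_1,\dots,z_N)$ lies in the interior of $A_N$, and the following holds. (a) For each $x_0$ in the interior of $A_N$, (1) has a unique solution $x$ on $[0,\infty)$. It satisfies the differential equation also at $t=0$ (with the one-sided derivative), $x(t)$ lies in the interior of $A_N$ for all $t\ge0$, and $\lim_{t\to\infty}x(t)=z$. (b) For each $x_0\in\partial A_N$, (1) has a unique solution $x$ on $[0,\infty)$ with values in $A_N$. Moreover, $x(t)$ lies in the interior of $A_N$ for all $t>0$, and $\lim_{t\to\infty}x(t)=z$. (c) The vector $z$ is the only stationary solution of (1) in $A_N$: for $w\in A_N$, the constant function $t\mapsto w$ is a solution of (1) with $x_0=w$ if and only if $w=z$. -/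

import Mathlib

open Set Filter Topology Polynomial

noncomputable section

/-- The alcove `A_N = {x ∈ ℝ^N : -1 ≤ x_1 ≤ … ≤ x_N ≤ 1}`. -/
def alcove (N : ℕ) : Set (Fin N → ℝ) :=
  {x | Monotone x ∧ ∀ i, x i ∈ Icc (-1 : ℝ) 1}

/-- The right-hand side of the ODE:
`(p - q) - (p + q) x_i + 2 ∑_{j ≠ i} (1 - x_i x_j) / (x_i - x_j)`.
It is meaningful only at points `x` with pairwise distinct coordinates. -/
def jacobiField {N : ℕ} (p q : ℝ) (x : Fin N → ℝ) : Fin N → ℝ := fun i =>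
  (p - q) - (p + q) * x i
    + 2 * ∑ j ∈ Finset.univ.erase i, (1 - x i * x j) / (x i - x j)

/-- `x` is a solution on `[0, ∞)` of the ODE with start in `x₀`: it is continuous on `[0, ∞)`,
starts in `x₀`, and at all times `t > 0` its coordinates are pairwise distinct (so that the
right-hand side is defined) and the ODE holds. Only the values of `x` on `[0, ∞)` matter. -/
structure IsJacobiSolution {N : ℕ} (p q : ℝ) (x₀ : Fin N → ℝ) (x : ℝ → Fin N → ℝ) : Prop where
  continuousOn : ContinuousOn x (Ici 0)
  start : x 0 = x₀
  distinct : ∀ t, 0 < t → Function.Injective (x t)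
  ode : ∀ t, 0 < t → HasDerivAt x (jacobiField p q (x t)) t

/-- The Jacobi polynomial in its classical normalization,
`P_n^{(α,β)}(x) = (1/n!) ∑_{k=0}^n binom(n,k) (n+α+β+1)_k (α+k+1)_{n-k} ((x-1)/2)^k`,
where `(a)_k = a (a+1) ⋯ (a+k-1)`. -/
def jacobiPoly (n : ℕ) (α β : ℝ) : ℝ[X] :=
  C ((n.factorial : ℝ)⁻¹) *
    ∑ k ∈ Finset.range (n + 1),
      C ((n.choose k : ℝ) * (ascPochhammer ℝ k).eval (n + α + β + 1)
          * (ascPochhammer ℝ (n - k)).eval (α + k + 1))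
        * (C (1 / 2) * (X - 1)) ^ k

end

/-! Encode a configuration by the monic polynomial H(t, y) = ∏ (y - x_i(t)). At a simple root,
H''/H' equals 2 ∑ 1/(x_i - x_j), so the singular nonlinear ODE turns into a linear equation ∂ₜH = M
H (`rootFlowOp_rootPoly`). By the Jacobi differential equation, M is diagonal in the polynomials
P_k^{(q-N,p-N)} with eigenvalues -(N-k)(p+q-N+1+k). Hence the coordinates of H are explicit
exponentials: decaying for k < N, constant for k = N. An ordered vector is determined by these
coordinates (`jacobiModes_injOn`), which yields uniqueness, continuity and the limit.

It remains to see that the explicit flow keeps N ordered real roots in [-1, 1]. In the interior the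
field is (1 - x_i²) times the i-th partial derivative of the log of `jacobiDensity`, so this density
never decreases, and its superlevel sets at positive levels, compact inside the interior, trap the
motion (`exists_mem_alcove_jacobiDensity_le`). Boundary starts follow by taking closures. They enter
the interior at once: the discriminant times ∏ (1 - x_i²) is symmetric, hence analytic in t along
the flow, and vanishing on an initial interval would force it to vanish at the interior limit z
(`mem_interior_of_pos`). -/

noncomputable section

/-! ### Jacobi polynomials as an eigenbasis of the linear operator -/

/-- The linear operator `M` such that `∂ₜ H = M H` for the monic polynomial `H(t, ·)` whose roots
move along the Jacobi ODE. -/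
def rootFlowOp (N : ℕ) (p q : ℝ) : ℝ[X] →ₗ[ℝ] ℝ[X] where
  toFun P := -((1 - X ^ 2) * derivative (derivative P))
    - (C (p - q) - C (p + q - 2 * N + 2) * X) * derivative P - C (N * (p + q - N + 1)) * P
  map_add' P Q := by simp only [derivative_add]; ring
  map_smul' c P := by
    simp only [derivative_smul, RingHom.id_apply, smul_sub, smul_neg, mul_smul_comm]

theorem rootFlowOp_apply (N : ℕ) (p q : ℝ) (P : ℝ[X]) :
    rootFlowOp N p q P = -((1 - X ^ 2) * derivative (derivative P))
      - (C (p - q) - C (p + q - 2 * N + 2) * X) * derivative P - C (N * (p + q - N + 1)) * P :=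
  rfl

/-- The decay rate of the `k`-th Jacobi polynomial under `rootFlowOp`. -/
def jacobiRate (N : ℕ) (p q : ℝ) (k : ℕ) : ℝ := (N - k) * (p + q - N + 1 + k)

/-- The coefficient of `u ^ j` in `n! P_n^{(α,β)}(1 + 2 u)`. -/
def jacobiCoeff (n : ℕ) (α β : ℝ) (j : ℕ) : ℝ :=
  (n.choose j : ℝ) * (ascPochhammer ℝ j).eval (n + α + β + 1)
    * (ascPochhammer ℝ (n - j)).eval (α + j + 1)

/-- The hypergeometric recursion, free of division and valid for every `j`: for `j ≥ n` both sides
vanish. It is the Jacobi differential equation read coefficientwise. -/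
theorem jacobiCoeff_succ (n : ℕ) (α β : ℝ) (j : ℕ) :
    ((j : ℝ) + 1) * (j + 1 + α) * jacobiCoeff n α β (j + 1)
      = (n - j) * (n + j + α + β + 1) * jacobiCoeff n α β j := by
  unfold jacobiCoeff
  rcases lt_trichotomy j n with h | h | h
  · obtain ⟨m, rfl⟩ : ∃ m, n = j + (m + 1) := ⟨n - j - 1, by omega⟩
    have h1 : j + (m + 1) - (j + 1) = m := by omega
    have h2 : j + (m + 1) - j = m + 1 := by omega
    have hc : (((j + (m + 1)).choose (j + 1) : ℕ) : ℝ) * (j + 1)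
        = ((j + (m + 1)).choose j : ℕ) * (m + 1) := by
      have := Nat.choose_succ_right_eq (j + (m + 1)) j
      rw [h2] at this
      exact_mod_cast this
    rw [h1, h2, ascPochhammer_succ_eval, ascPochhammer_succ_left, eval_mul, eval_comp]
    simp only [eval_X, eval_add, eval_one, Nat.cast_add, Nat.cast_one]
    rw [show α + ((j : ℝ) + 1) + 1 = α + j + 1 + 1 by ring]
    linear_combination (j + 1 + α) * eval (↑j + (↑m + 1) + α + β + 1) (ascPochhammer ℝ j)
      * (↑j + (↑m + 1) + α + β + 1 + j) * eval (α + ↑j + 1 + 1) (ascPochhammer ℝ m) * hc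
  · subst h; simp
  · simp [Nat.choose_eq_zero_of_lt h, Nat.choose_eq_zero_of_lt (Nat.lt_succ_of_lt h)]

/-- `n! P_n^{(α,β)}(1 + 2 X)`. -/
def shiftedJacobi (n : ℕ) (α β : ℝ) : ℝ[X] :=
  ∑ k ∈ Finset.range (n + 1), C (jacobiCoeff n α β k) * X ^ k

theorem shiftedJacobi_coeff (n : ℕ) (α β : ℝ) (j : ℕ) :
    (shiftedJacobi n α β).coeff j = jacobiCoeff n α β j := by
  simp only [shiftedJacobi, finsetSum_coeff, coeff_C_mul_X_pow, Finset.sum_ite_eq,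
    Finset.mem_range]
  split_ifs with h
  · rfl
  · simp [jacobiCoeff, Nat.choose_eq_zero_of_lt (show n < j by omega)]

theorem shiftedJacobi_ode (n : ℕ) (α β : ℝ) :
    (X + X ^ 2) * derivative (derivative (shiftedJacobi n α β))
      + (C (α + 1) + C (α + β + 2) * X) * derivative (shiftedJacobi n α β)
      = C (n * (n + α + β + 1)) * shiftedJacobi n α β := by
  ext j
  have h := jacobiCoeff_succ n α β j
  rcases j with _ | _ | j
  · simp [add_mul, mul_assoc, pow_two, coeff_derivative, shiftedJacobi_coeff] at h ⊢
    linear_combination h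
  · simp [add_mul, mul_assoc, pow_two, coeff_derivative, shiftedJacobi_coeff, coeff_X_mul] at h ⊢
    norm_num at h ⊢
    linear_combination h
  · simp [add_mul, mul_assoc, pow_two, coeff_derivative, shiftedJacobi_coeff, coeff_X_mul] at h ⊢
    linear_combination h

theorem jacobiPoly_eq_comp (n : ℕ) (α β : ℝ) :
    jacobiPoly n α β
      = C ((n.factorial : ℝ)⁻¹) * (shiftedJacobi n α β).comp (C (1 / 2) * (X - 1)) := by
  simp only [jacobiPoly, shiftedJacobi, jacobiCoeff, ← coe_compRingHom_apply, map_sum, map_mul,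
    map_pow]
  simp

theorem jacobiPoly_ode (n : ℕ) (α β : ℝ) :
    (1 - X ^ 2) * derivative (derivative (jacobiPoly n α β))
      + (C (β - α) - C (α + β + 2) * X) * derivative (jacobiPoly n α β)
      = -(C (n * (n + α + β + 1)) * jacobiPoly n α β) := by
  have h := congrArg (fun P : ℝ[X] => P.comp (C (1 / 2) * (X - 1))) (shiftedJacobi_ode n α β)
  simp only [add_comp, mul_comp, C_comp, X_comp, pow_comp] at h
  have hC : (C (1 / 2) : ℝ[X]) * 2 = 1 := by
    rw [show (2 : ℝ[X]) = C 2 from rfl, ← C_mul]; norm_num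
  rw [jacobiPoly_eq_comp]
  set Q := shiftedJacobi n α β
  simp only [derivative_mul, derivative_C, zero_mul, zero_add, derivative_comp, derivative_sub,
    derivative_X, derivative_one, sub_zero, mul_one]
  set Q0 := Q.comp (C (1 / 2) * (X - 1))
  set Q1 := (derivative Q).comp (C (1 / 2) * (X - 1))
  set Q2 := (derivative (derivative Q)).comp (C (1 / 2) * (X - 1))
  set c : ℝ[X] := C (1 / 2)
  set f : ℝ[X] := C ((n.factorial : ℝ)⁻¹)
  simp only [C_add, C_sub, C_mul, C_1, show (C 2 : ℝ[X]) = 2 from rfl] at h ⊢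
  linear_combination (-f) * h - (X * f * c * Q2 - f * c * Q2 + f * C α * Q1 + f * Q1) * hC

theorem rootFlowOp_jacobiPoly (N : ℕ) (p q : ℝ) (k : ℕ) :
    rootFlowOp N p q (jacobiPoly k (q - N) (p - N))
      = (-jacobiRate N p q k) • jacobiPoly k (q - N) (p - N) := by
  have h := jacobiPoly_ode k (q - N) (p - N)
  rw [rootFlowOp_apply, smul_eq_C_mul]
  rw [show p - N - (q - N) = p - q by ring, show q - N + (p - N) + 2 = p + q - 2 * N + 2 by ring]
    at h
  have hc : (C (-jacobiRate N p q k) : ℝ[X])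
      = C (k * (k + (q - N) + (p - N) + 1)) - C (N * (p + q - N + 1)) := by
    rw [← C_sub]; congr 1; unfold jacobiRate; ring
  rw [hc]
  linear_combination -h

theorem jacobiPoly_degree {α β : ℝ} (hαβ : -2 < α + β) (n : ℕ) :
    (jacobiPoly n α β).degree = n := by
  have hlead : (shiftedJacobi n α β).coeff n ≠ 0 := by
    rw [shiftedJacobi_coeff]
    simp only [jacobiCoeff, Nat.choose_self, Nat.cast_one, one_mul, Nat.sub_self,
      ascPochhammer_zero, eval_one, mul_one]
    rcases n with _ | n
    · simp
    -- The bound -2 < α + β enters here: it makes n + α + β + 1 positive in every degree n ≥ 1, so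
    -- the leading coefficient survives.
    · refine (ascPochhammer_pos _ _ ?_).ne'
      push_cast
      have : (0 : ℝ) ≤ n := n.cast_nonneg
      linarith
  have hdeg : (shiftedJacobi n α β).natDegree = n := by
    refine natDegree_eq_of_le_of_coeff_ne_zero ?_ hlead
    refine natDegree_sum_le_of_forall_le _ _ fun i hi => ?_
    exact (natDegree_C_mul_X_pow_le _ _).trans (Nat.lt_succ_iff.mp (Finset.mem_range.mp hi))
  have hf : ((n.factorial : ℝ)⁻¹) ≠ 0 := inv_ne_zero (by exact_mod_cast n.factorial_ne_zero)
  have hlin : (C (1 / 2) * (X - 1) : ℝ[X]).natDegree = 1 := by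
    rw [natDegree_C_mul (by norm_num), ← C_1, natDegree_X_sub_C]
  have hnat : (jacobiPoly n α β).natDegree = n := by
    rw [jacobiPoly_eq_comp, natDegree_C_mul hf, natDegree_comp, hdeg, hlin, mul_one]
  have hne : jacobiPoly n α β ≠ 0 := by
    rcases Nat.eq_zero_or_pos n with h | h
    · subst h
      simp [jacobiPoly]
    · rintro h0
      rw [h0, natDegree_zero] at hnat
      omega
  rw [degree_eq_natDegree hne, hnat]

/-- The Jacobi polynomials as a sequence of polynomials with one element in each degree. -/
def jacobiSequence {α β : ℝ} (hαβ : -2 < α + β) : Polynomial.Sequence ℝ where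
  elems' n := jacobiPoly n α β
  degree_eq' := jacobiPoly_degree hαβ

/-- The basis of `ℝ[X]` consisting of the Jacobi polynomials. -/
def jacobiBasis {α β : ℝ} (hαβ : -2 < α + β) : Module.Basis ℕ ℝ ℝ[X] :=
  (jacobiSequence hαβ).basis fun i =>
    (leadingCoeff_ne_zero.mpr ((jacobiSequence hαβ).ne_zero i)).isUnit

theorem jacobiBasis_apply {α β : ℝ} (hαβ : -2 < α + β) (n : ℕ) :
    jacobiBasis hαβ n = jacobiPoly n α β :=
  Polynomial.Sequence.basis_eq_self _ _ n

theorem jacobiBasis_repr_eq_zero {α β : ℝ} (hαβ : -2 < α + β) {P : ℝ[X]} {n k : ℕ}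
    (hP : P.natDegree ≤ n) (hk : n < k) : (jacobiBasis hαβ).repr P k = 0 := by
  have hmem : P ∈ Submodule.span ℝ (jacobiSequence hαβ '' Iic n) := by
    rw [Polynomial.Sequence.span_degreeLE _ fun i _ =>
      (leadingCoeff_ne_zero.mpr ((jacobiSequence hαβ).ne_zero i)).isUnit, mem_degreeLE]
    exact natDegree_le_iff_degree_le.mp hP
  have hmem' : P ∈ Submodule.span ℝ (jacobiBasis hαβ '' Iic n) := by
    rwa [show ⇑(jacobiBasis hαβ) = jacobiSequence hαβ from funext (jacobiBasis_apply hαβ)]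
  rw [Module.Basis.mem_span_image] at hmem'
  by_contra h
  have := hmem' (Finsupp.mem_support_iff.mpr h)
  simp only [mem_Iic] at this
  omega

theorem jacobiBasis_repr_rootFlowOp {N : ℕ} {p q : ℝ} (h : -2 < (q - N) + (p - N)) (P : ℝ[X])
    (k : ℕ) :
    (jacobiBasis h).repr (rootFlowOp N p q P) k
      = -jacobiRate N p q k * (jacobiBasis h).repr P k := by
  have key : (Finsupp.lapply k ∘ₗ (jacobiBasis h).repr.toLinearMap) ∘ₗ rootFlowOp N p q
      = (-jacobiRate N p q k) • (Finsupp.lapply k ∘ₗ (jacobiBasis h).repr.toLinearMap) := by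
    refine (jacobiBasis h).ext fun i => ?_
    have hi : rootFlowOp N p q (jacobiBasis h i) = (-jacobiRate N p q i) • jacobiBasis h i := by
      rw [jacobiBasis_apply, rootFlowOp_jacobiPoly]
    simp only [LinearMap.comp_apply, hi, LinearMap.smul_apply, LinearEquiv.coe_coe, map_smul,
      Module.Basis.repr_self, Finsupp.lapply_apply, Finsupp.single_apply, smul_eq_mul]
    split_ifs with hik
    · rw [hik]
    · simp
  simpa using LinearMap.congr_fun key P

theorem rootFlowOp_coeff (N : ℕ) (p q : ℝ) (P : ℝ[X]) (j : ℕ) :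
    (rootFlowOp N p q P).coeff j = (j * (j - 1) + (p + q - 2 * N + 2) * j
      - N * (p + q - N + 1)) * P.coeff j - (p - q) * (j + 1) * P.coeff (j + 1)
      - (j + 1) * (j + 2) * P.coeff (j + 2) := by
  rcases j with _ | _ | j
  · simp [rootFlowOp_apply, sub_mul, mul_assoc, pow_two, coeff_derivative, -map_sub, -map_add, -map_mul]
    ring
  · simp [rootFlowOp_apply, sub_mul, mul_assoc, pow_two, coeff_derivative, -map_sub, -map_add, -map_mul]
    ring
  · simp [rootFlowOp_apply, sub_mul, mul_assoc, pow_two, coeff_derivative, -map_sub, -map_add, -map_mul]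
    ring

/-- The zeroth-order constant of the operator is chosen to cancel the coefficient of X^N, in
accordance with H staying monic. -/
theorem rootFlowOp_degree_lt {N : ℕ} (p q : ℝ) {P : ℝ[X]} (hP : P.natDegree ≤ N) :
    (rootFlowOp N p q P).degree < N := by
  rw [degree_lt_iff_coeff_zero]
  intro m hm
  have h1 : P.coeff (m + 1) = 0 := coeff_eq_zero_of_natDegree_lt (by omega)
  have h2 : P.coeff (m + 2) = 0 := coeff_eq_zero_of_natDegree_lt (by omega)
  rw [rootFlowOp_coeff, h1, h2]
  rcases hm.eq_or_lt with h | h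
  · subst h; ring
  · rw [coeff_eq_zero_of_natDegree_lt (by omega : P.natDegree < m)]; ring

/-! ### Linearization of the ODE through the root polynomial -/

/-- The monic polynomial with roots `x i`. -/
def rootPoly {N : ℕ} (x : Fin N → ℝ) : ℝ[X] := ∏ i, (X - C (x i))

theorem rootPoly_monic {N : ℕ} (x : Fin N → ℝ) : (rootPoly x).Monic :=
  monic_prod_of_monic _ _ fun i _ => monic_X_sub_C (x i)

theorem rootPoly_natDegree {N : ℕ} (x : Fin N → ℝ) : (rootPoly x).natDegree = N := by
  simp [rootPoly]

theorem rootPoly_eval {N : ℕ} (x : Fin N → ℝ) (y : ℝ) :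
    (rootPoly x).eval y = ∏ i, (y - x i) := by
  simp [rootPoly, eval_prod]

theorem rootPoly_roots {N : ℕ} (x : Fin N → ℝ) :
    (rootPoly x).roots = Finset.univ.val.map x := by
  rw [← roots_multiset_prod_X_sub_C (Finset.univ.val.map x), Multiset.map_map]
  rfl

theorem eq_of_monotone_of_multiset_map_eq {N : ℕ} {x y : Fin N → ℝ} (hx : Monotone x)
    (hy : Monotone y) (h : Finset.univ.val.map x = Finset.univ.val.map y) : x = y := by
  have h' : (List.ofFn x).Perm (List.ofFn y) := by
    rw [← Multiset.coe_eq_coe]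
    simpa [List.ofFn_eq_map] using! h
  exact List.ofFn_injective (List.Perm.eq_of_sortedLE hx.sortedLE_ofFn hy.sortedLE_ofFn h')

theorem eq_of_rootPoly_eq {N : ℕ} {x y : Fin N → ℝ} (hx : Monotone x) (hy : Monotone y)
    (h : rootPoly x = rootPoly y) : x = y :=
  eq_of_monotone_of_multiset_map_eq hx hy (by rw [← rootPoly_roots, h, rootPoly_roots])

theorem rootPoly_eq_mul_erase {N : ℕ} (x : Fin N → ℝ) (i : Fin N) :
    rootPoly x = (X - C (x i)) * ∏ j ∈ Finset.univ.erase i, (X - C (x j)) :=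
  (Finset.mul_prod_erase _ _ (Finset.mem_univ i)).symm

theorem eval_derivative_prod_X_sub_C {ι : Type*} [DecidableEq ι] (s : Finset ι) (x : ι → ℝ)
    (y : ℝ) (h : ∀ j ∈ s, y ≠ x j) :
    (derivative (∏ j ∈ s, (X - C (x j)))).eval y
      = (∏ j ∈ s, (y - x j)) * ∑ j ∈ s, (y - x j)⁻¹ := by
  rw [derivative_prod_finset, eval_finsetSum, Finset.mul_sum]
  refine Finset.sum_congr rfl fun j hj => ?_
  rw [← Finset.mul_prod_erase s (fun j => y - x j) hj]
  have : y - x j ≠ 0 := sub_ne_zero.mpr (h j hj)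
  simp only [derivative_X_sub_C, mul_one, eval_prod, eval_sub, eval_X, eval_C]
  field_simp

/-- From (1 - ab)/(a - b) = (1 - a²)/(a - b) + a. The factor 1 - x_i² then matches the second-order
coefficient of `rootFlowOp`. -/
theorem jacobiField_eq {N : ℕ} (p q : ℝ) {x : Fin N → ℝ} (hx : Function.Injective x) (i : Fin N) :
    jacobiField p q x i = (p - q) - (p + q - 2 * N + 2) * x i
      + 2 * (1 - x i ^ 2) * ∑ j ∈ Finset.univ.erase i, (x i - x j)⁻¹ := by
  have h : ∀ j ∈ Finset.univ.erase i,
      (1 - x i * x j) / (x i - x j) = (1 - x i ^ 2) * (x i - x j)⁻¹ + x i := by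
    intro j hj
    have : x i - x j ≠ 0 := sub_ne_zero.mpr fun h => (Finset.ne_of_mem_erase hj) (hx h).symm
    field_simp
    ring
  have hN : 1 ≤ N := Nat.one_le_iff_ne_zero.mpr fun h => by subst h; exact i.elim0
  rw [jacobiField, Finset.sum_congr rfl h, Finset.sum_add_distrib, ← Finset.mul_sum]
  simp only [Finset.sum_const, Finset.card_erase_of_mem (Finset.mem_univ i), Finset.card_univ,
    Fintype.card_fin, nsmul_eq_mul, Nat.cast_sub hN, Nat.cast_one]
  ring

theorem rootFlowOp_rootPoly_eval {N : ℕ} (p q : ℝ) {x : Fin N → ℝ} (hx : Function.Injective x)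
    (i : Fin N) :
    (rootFlowOp N p q (rootPoly x)).eval (x i)
      = -(jacobiField p q x i * ∏ j ∈ Finset.univ.erase i, (x i - x j)) := by
  have hne : ∀ j ∈ Finset.univ.erase i, x i ≠ x j :=
    fun j hj h => (Finset.ne_of_mem_erase hj) (hx h).symm
  have hd := eval_derivative_prod_X_sub_C _ x (x i) hne
  rw [jacobiField_eq p q hx, rootFlowOp_apply, rootPoly_eq_mul_erase x i]
  set R := ∏ j ∈ Finset.univ.erase i, (X - C (x j)) with hR
  have hRe : R.eval (x i) = ∏ j ∈ Finset.univ.erase i, (x i - x j) := by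
    simp [hR, eval_prod]
  rw [← hRe] at hd ⊢
  simp only [derivative_mul, derivative_add, derivative_sub, derivative_X, derivative_C, sub_zero,
    eval_add, eval_sub, eval_mul, eval_neg, eval_X, eval_C, eval_pow, eval_one,
    sub_self, zero_mul, one_mul, hd, mul_zero, add_zero]
  ring

/-- Both sides have degree below N and agree at the N distinct points `x i`. The right side is the
time derivative of the product when the roots move with the field. -/
theorem rootFlowOp_rootPoly {N : ℕ} (p q : ℝ) {x : Fin N → ℝ} (hx : Function.Injective x) :
    rootFlowOp N p q (rootPoly x)
      = -∑ i, C (jacobiField p q x i) * ∏ j ∈ Finset.univ.erase i, (X - C (x j)) := by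
  refine eq_of_degrees_lt_of_eval_index_eq (v := x) Finset.univ hx.injOn ?_ ?_ fun i _ => ?_
  · simpa using rootFlowOp_degree_lt p q (rootPoly_natDegree x).le
  · rw [degree_neg]
    refine (degree_sum_le _ _).trans_lt ?_
    rw [Finset.sup_lt_iff (WithBot.bot_lt_coe _)]
    intro i _
    rw [← smul_eq_C_mul]
    refine (degree_smul_le _ _).trans_lt ?_
    rw [degree_prod]
    simp only [degree_X_sub_C, Finset.sum_const, nsmul_eq_mul, mul_one]
    exact_mod_cast Finset.card_erase_lt_of_mem (Finset.mem_univ i)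
  · rw [rootFlowOp_rootPoly_eval p q hx, eval_neg, eval_finsetSum, Finset.sum_eq_single i]
    · simp [eval_prod]
    · intro j _ hji
      rw [eval_mul, eval_prod, Finset.prod_eq_zero (Finset.mem_erase.mpr ⟨hji.symm,
        Finset.mem_univ i⟩) (by simp), mul_zero]
    · simp

theorem hasDerivAt_rootPoly_eval {N : ℕ} {p q : ℝ} {x : ℝ → Fin N → ℝ} {t : ℝ}
    (hx : Function.Injective (x t)) (h : HasDerivAt x (jacobiField p q (x t)) t) (y : ℝ) :
    HasDerivAt (fun s => (rootPoly (x s)).eval y)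
      ((rootFlowOp N p q (rootPoly (x t))).eval y) t := by
  have hprod := HasDerivAt.fun_finsetProd (u := Finset.univ)
    (f := fun i s => y - x s i) (f' := fun i => -jacobiField p q (x t) i) (x := t)
    fun i _ => ((hasDerivAt_pi.mp h) i).const_sub y
  simp only [rootPoly_eval]
  refine hprod.congr_deriv (Eq.symm ?_)
  rw [rootFlowOp_rootPoly p q hx, eval_neg, eval_finsetSum, ← Finset.sum_neg_distrib]
  refine Finset.sum_congr rfl fun i _ => ?_
  simp [eval_prod, mul_comm]

/-- Lagrange interpolation at 0, …, n reduces continuity and differentiation of a coordinate to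
those of finitely many point evaluations, so no topology on polynomials is needed. -/
theorem linearMap_eq_sum_eval (L : ℝ[X] →ₗ[ℝ] ℝ) {n : ℕ} {P : ℝ[X]} (hP : P.natDegree ≤ n) :
    L P = ∑ m ∈ Finset.range (n + 1),
      P.eval (m : ℝ) * L (Lagrange.basis (Finset.range (n + 1)) (fun m : ℕ => (m : ℝ)) m) := by
  have h := Lagrange.eq_interpolate (s := Finset.range (n + 1)) (v := fun m : ℕ => (m : ℝ))
    (f := P) Nat.cast_injective.injOn (by
      rw [Finset.card_range]
      exact (natDegree_le_iff_degree_le.mp hP).trans_lt (by exact_mod_cast Nat.lt_succ_self n))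
  conv_lhs => rw [h, Lagrange.interpolate_apply]
  simp [← smul_eq_C_mul]

/-! ### Jacobi coordinates and their exponential evolution -/

/-- The coordinates of the polynomial with roots `x` in the basis of Jacobi polynomials. -/
def jacobiModes {N : ℕ} {p q : ℝ} (h : -2 < (q - N) + (p - N)) (x : Fin N → ℝ) (k : ℕ) : ℝ :=
  (jacobiBasis h).repr (rootPoly x) k

section modes

variable {N : ℕ} {p q : ℝ} (h : -2 < (q - N) + (p - N))

theorem jacobiModes_eq_sum (x : Fin N → ℝ) (k : ℕ) :
    jacobiModes h x k = ∑ m ∈ Finset.range (N + 1), (rootPoly x).eval (m : ℝ) *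
      (jacobiBasis h).repr
        (Lagrange.basis (Finset.range (N + 1)) (fun m : ℕ => (m : ℝ)) m) k :=
  linearMap_eq_sum_eval (Finsupp.lapply k ∘ₗ (jacobiBasis h).repr.toLinearMap)
    (rootPoly_natDegree x).le

theorem continuous_jacobiModes : Continuous (jacobiModes (N := N) h) := by
  refine continuous_pi fun k => ?_
  simp only [jacobiModes_eq_sum, rootPoly_eval]
  fun_prop

theorem jacobiModes_injOn : InjOn (jacobiModes (N := N) h) {x | Monotone x} := by
  intro x hx y hy hxy
  refine eq_of_rootPoly_eq hx hy ((jacobiBasis h).repr.injective (Finsupp.ext fun k => ?_))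
  exact congrFun hxy k

theorem jacobiModes_eq_zero (x : Fin N → ℝ) {k : ℕ} (hk : N < k) : jacobiModes h x k = 0 :=
  jacobiBasis_repr_eq_zero h (rootPoly_natDegree x).le hk

theorem hasDerivAt_jacobiModes {x : ℝ → Fin N → ℝ} {t : ℝ} (hx : Function.Injective (x t))
    (hd : HasDerivAt x (jacobiField p q (x t)) t) (k : ℕ) :
    HasDerivAt (fun s => jacobiModes h (x s) k)
      (-jacobiRate N p q k * jacobiModes h (x t) k) t := by
  have hL := linearMap_eq_sum_eval (Finsupp.lapply k ∘ₗ (jacobiBasis h).repr.toLinearMap)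
    (natDegree_le_of_degree_le (rootFlowOp_degree_lt p q (rootPoly_natDegree (x t)).le).le)
  have hL' : (jacobiBasis h).repr (rootFlowOp N p q (rootPoly (x t))) k = _ := hL
  rw [jacobiModes, ← jacobiBasis_repr_rootFlowOp, hL']
  simp only [jacobiModes_eq_sum]
  exact HasDerivAt.fun_sum fun m _ => (hasDerivAt_rootPoly_eval hx hd m).mul_const _

/-- The mean value theorem shows that exp(μt) times the coordinate has equal values at both ends.
The ODE is needed only on the open interval, so a singular starting point is allowed. -/
theorem jacobiModes_eq_exp_mul {x : ℝ → Fin N → ℝ} {a b : ℝ} (hab : a ≤ b)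
    (hc : ContinuousOn x (Icc a b)) (hinj : ∀ t ∈ Ioo a b, Function.Injective (x t))
    (hd : ∀ t ∈ Ioo a b, HasDerivAt x (jacobiField p q (x t)) t) (k : ℕ) :
    jacobiModes h (x b) k
      = Real.exp (-jacobiRate N p q k * (b - a)) * jacobiModes h (x a) k := by
  rcases hab.eq_or_lt with rfl | hab
  · simp
  set μ := jacobiRate N p q k
  have hcont : ContinuousOn (fun t => Real.exp (μ * t) * jacobiModes h (x t) k) (Icc a b) := by
    refine ContinuousOn.mul (by fun_prop) ?_
    exact ((continuous_apply k).comp (continuous_jacobiModes h)).comp_continuousOn hc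
  obtain ⟨c, hc, hc'⟩ := exists_hasDerivAt_eq_slope _
    (fun t => Real.exp (μ * t) * μ * jacobiModes h (x t) k
      + Real.exp (μ * t) * (-μ * jacobiModes h (x t) k)) hab hcont fun t ht =>
    HasDerivAt.fun_mul (by simpa using ((hasDerivAt_id t).const_mul μ).exp)
      (hasDerivAt_jacobiModes h (hinj t ht) (hd t ht) k)
  have h0 : Real.exp (μ * b) * jacobiModes h (x b) k = Real.exp (μ * a) * jacobiModes h (x a) k := by
    have : b - a ≠ 0 := by linarith
    field_simp at hc'
    linarith
  have : Real.exp (-μ * (b - a)) = Real.exp (μ * a) / Real.exp (μ * b) := by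
    rw [← Real.exp_sub]; ring_nf
  rw [this]
  field_simp
  linarith

end modes

/-! ### Topology of the alcove -/

theorem isClosed_alcove (N : ℕ) : IsClosed (alcove N) := by
  have : alcove N = {x | Monotone x} ∩ ⋂ i, {x | x i ∈ Icc (-1 : ℝ) 1} := by
    ext x; simp [alcove]
  rw [this]
  refine isClosed_monotone.inter (isClosed_iInter fun i => ?_)
  exact isClosed_Icc.preimage (continuous_apply i)

theorem isCompact_alcove (N : ℕ) : IsCompact (alcove N) := by
  refine (isCompact_univ_pi fun _ : Fin N => isCompact_Icc (a := (-1 : ℝ)) (b := 1)).of_isClosed_subset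
    (isClosed_alcove N) fun x hx i _ => hx.2 i

theorem isOpen_strictMono_Ioo (N : ℕ) :
    IsOpen {x : Fin N → ℝ | StrictMono x ∧ ∀ i, x i ∈ Ioo (-1 : ℝ) 1} := by
  have : {x : Fin N → ℝ | StrictMono x ∧ ∀ i, x i ∈ Ioo (-1 : ℝ) 1}
      = (⋂ i, ⋂ j, ⋂ (_ : i < j), {x | x i < x j}) ∩ ⋂ i, {x | x i ∈ Ioo (-1 : ℝ) 1} := by
    ext x; simp [StrictMono]
  rw [this]
  refine IsOpen.inter ?_ (isOpen_iInter_of_finite fun i => isOpen_Ioo.preimage (continuous_apply i))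
  exact isOpen_iInter_of_finite fun i => isOpen_iInter_of_finite fun j =>
    isOpen_iInter_of_finite fun _ => isOpen_lt (continuous_apply i) (continuous_apply j)

theorem interior_alcove (N : ℕ) :
    interior (alcove N) = {x | StrictMono x ∧ ∀ i, x i ∈ Ioo (-1 : ℝ) 1} := by
  refine Subset.antisymm (fun x hx => ?_) (interior_maximal (fun x hx => ⟨hx.1.monotone,
    fun i => Ioo_subset_Icc_self (hx.2 i)⟩) (isOpen_strictMono_Ioo N))
  -- An interior point stays in the alcove when a single coordinate is moved slightly either way;
  -- this makes all inequalities strict.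
  have hshift : ∀ i, ∃ ε > 0, Function.update x i (x i + ε) ∈ alcove N ∧
      Function.update x i (x i - ε) ∈ alcove N := by
    intro i
    have hc : Tendsto (fun s : ℝ => Function.update x i (x i + s)) (𝓝 0) (𝓝 x) := by
      have : Continuous (fun s : ℝ => Function.update x i (x i + s)) :=
        continuous_const.update i (by fun_prop)
      simpa using this.tendsto 0
    obtain ⟨δ, hδ, hball⟩ := Metric.eventually_nhds_iff.mp (hc.eventually
      (isOpen_interior.mem_nhds hx))
    refine ⟨δ / 2, by positivity, interior_subset (hball ?_), ?_⟩
    · rw [Real.dist_eq, sub_zero, abs_of_pos (by positivity)]; linarith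
    · refine interior_subset (hball (y := -(δ / 2)) ?_)
      rw [Real.dist_eq, sub_zero, abs_neg, abs_of_pos (by positivity)]; linarith
  refine ⟨fun i j hij => ?_, fun i => ?_⟩
  · obtain ⟨ε, hε, h1, -⟩ := hshift i
    have := h1.1 hij.le
    rw [Function.update_self, Function.update_of_ne hij.ne'] at this
    linarith
  · obtain ⟨ε, hε, h1, h2⟩ := hshift i
    have h1 := (h1.2 i).2
    have h2 := (h2.2 i).1
    rw [Function.update_self] at h1 h2
    exact ⟨by linarith, by linarith⟩

theorem convex_alcove (N : ℕ) : Convex ℝ (alcove N) := by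
  intro x hx y hy a b ha hb hab
  refine ⟨fun i j hij => ?_, fun i => convex_Icc (-1 : ℝ) 1 (hx.2 i) (hy.2 i) ha hb hab⟩
  have h1 := mul_le_mul_of_nonneg_left (hx.1 hij) ha
  have h2 := mul_le_mul_of_nonneg_left (hy.1 hij) hb
  simpa using add_le_add h1 h2

theorem interior_alcove_nonempty (N : ℕ) : (interior (alcove N)).Nonempty := by
  refine ⟨fun i => (i : ℝ) / N, ?_⟩
  rw [interior_alcove]
  refine ⟨fun i j hij => ?_, fun i => ?_⟩ <;> have hN : (0 : ℝ) < N := by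
    exact_mod_cast i.pos
  · exact div_lt_div_of_pos_right (by exact_mod_cast hij) hN
  · have h0 : (0 : ℝ) ≤ (i : ℕ) / N := by positivity
    exact ⟨by linarith, (div_lt_one hN).mpr (by exact_mod_cast i.2)⟩

theorem closure_interior_alcove (N : ℕ) : closure (interior (alcove N)) = alcove N := by
  rw [(convex_alcove N).closure_interior_eq_closure_of_nonempty_interior
    (interior_alcove_nonempty N), (isClosed_alcove N).closure_eq]

/-! ### The density as a Lyapunov function -/

/-- The stationary density of the Jacobi ensemble. It is nondecreasing along the ODE. -/
def jacobiDensity {N : ℕ} (p q : ℝ) (x : Fin N → ℝ) : ℝ :=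
  (∏ i, ∏ j ∈ Finset.univ.erase i, |x i - x j|)
    * ∏ i, ((1 + x i) ^ (p - N + 1) * (1 - x i) ^ (q - N + 1))

/-- The logarithm of `jacobiDensity`. -/
def jacobiLogDensity {N : ℕ} (p q : ℝ) (x : Fin N → ℝ) : ℝ :=
  (∑ i, ∑ j ∈ Finset.univ.erase i, Real.log (x i - x j))
    + ∑ i, ((p - N + 1) * Real.log (1 + x i) + (q - N + 1) * Real.log (1 - x i))

theorem continuous_jacobiDensity {N : ℕ} {p q : ℝ} (hp : (N : ℝ) - 1 < p) (hq : (N : ℝ) - 1 < q) :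
    Continuous (jacobiDensity (N := N) p q) := by
  have hp' : 0 ≤ p - N + 1 := by linarith
  have hq' : 0 ≤ q - N + 1 := by linarith
  refine Continuous.mul (by fun_prop) (continuous_finsetProd _ fun i _ => Continuous.mul ?_ ?_)
  · exact (Real.continuous_rpow_const hp').comp (by fun_prop)
  · exact (Real.continuous_rpow_const hq').comp (by fun_prop)

theorem jacobiDensity_eq_exp {N : ℕ} (p q : ℝ) {x : Fin N → ℝ} (hx : x ∈ interior (alcove N)) :
    jacobiDensity p q x = Real.exp (jacobiLogDensity p q x) := by
  rw [interior_alcove] at hx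
  simp only [jacobiLogDensity, Real.exp_add, Real.exp_sum, jacobiDensity]
  congr 1
  · refine Finset.prod_congr rfl fun i _ => Finset.prod_congr rfl fun j hj => ?_
    refine (Real.exp_log_eq_abs (sub_ne_zero.mpr fun h => ?_)).symm
    exact (Finset.ne_of_mem_erase hj) (hx.1.injective h).symm
  · refine Finset.prod_congr rfl fun i _ => ?_
    obtain ⟨h1, h2⟩ := hx.2 i
    rw [Real.rpow_def_of_pos (by linarith), Real.rpow_def_of_pos (by linarith), mul_comm (Real.log _),
      mul_comm (Real.log _)]

/-- The exponents p - N + 1 and q - N + 1 are positive, so the density vanishes on every wall of the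
alcove. -/
theorem mem_interior_alcove_of_jacobiDensity_pos {N : ℕ} {p q : ℝ} (hp : (N : ℝ) - 1 < p)
    (hq : (N : ℝ) - 1 < q) {x : Fin N → ℝ} (hx : x ∈ alcove N) (h : 0 < jacobiDensity p q x) :
    x ∈ interior (alcove N) := by
  have hp' : p - N + 1 ≠ 0 := by linarith
  have hq' : q - N + 1 ≠ 0 := by linarith
  rw [jacobiDensity, ← Finset.prod_mul_distrib] at h
  have h0 := Finset.prod_ne_zero_iff.mp h.ne'
  rw [interior_alcove]
  refine ⟨hx.1.strictMono_of_injective fun i j hij => ?_, fun i => ?_⟩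
  · by_contra hne
    have := Finset.prod_ne_zero_iff.mp (left_ne_zero_of_mul (h0 i (Finset.mem_univ i))) j
      (Finset.mem_erase.mpr ⟨fun h => hne h.symm, Finset.mem_univ j⟩)
    rw [hij] at this
    simp at this
  · have h1 := right_ne_zero_of_mul (h0 i (Finset.mem_univ i))
    obtain ⟨h2, h3⟩ := hx.2 i
    refine ⟨lt_of_le_of_ne h2 fun h => ?_, lt_of_le_of_ne h3 fun h => ?_⟩
    · rw [← h] at h1
      simp [Real.zero_rpow hp'] at h1
    · rw [h] at h1
      simp [Real.zero_rpow hq'] at h1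

/-- The bracket is the i-th partial derivative of `jacobiLogDensity`: the ODE is a gradient flow for
a weighted metric. -/
theorem jacobiField_eq_mul {N : ℕ} (p q : ℝ) {x : Fin N → ℝ} (hx : x ∈ interior (alcove N))
    (i : Fin N) :
    jacobiField p q x i = (1 - x i ^ 2) * (2 * ∑ j ∈ Finset.univ.erase i, (x i - x j)⁻¹
      + (p - N + 1) * (1 + x i)⁻¹ - (q - N + 1) * (1 - x i)⁻¹) := by
  rw [interior_alcove] at hx
  obtain ⟨h1, h2⟩ := hx.2 i
  have h3 : 1 + x i ≠ 0 := by linarith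
  have h4 : 1 - x i ≠ 0 := by linarith
  rw [jacobiField_eq p q hx.1.injective]
  set S := ∑ j ∈ Finset.univ.erase i, (x i - x j)⁻¹
  field_simp
  ring

theorem hasDerivAt_jacobiLogDensity {N : ℕ} {p q : ℝ} {x : ℝ → Fin N → ℝ} {t : ℝ}
    {v : Fin N → ℝ} (hx : x t ∈ interior (alcove N)) (hd : HasDerivAt x v t) :
    HasDerivAt (fun s => jacobiLogDensity p q (x s))
      (∑ i, v i * (2 * ∑ j ∈ Finset.univ.erase i, (x t i - x t j)⁻¹
        + (p - N + 1) * (1 + x t i)⁻¹ - (q - N + 1) * (1 - x t i)⁻¹)) t := by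
  rw [interior_alcove] at hx
  have hd' := hasDerivAt_pi.mp hd
  have h1 : HasDerivAt (fun s => ∑ i, ∑ j ∈ Finset.univ.erase i, Real.log (x s i - x s j))
      (∑ i, ∑ j ∈ Finset.univ.erase i, (v i - v j) / (x t i - x t j)) t := by
    refine HasDerivAt.fun_sum fun i _ => HasDerivAt.fun_sum fun j hj => ?_
    refine ((hd' i).fun_sub (hd' j)).log (sub_ne_zero.mpr fun h => ?_)
    exact (Finset.ne_of_mem_erase hj) (hx.1.injective h).symm
  have h2 : HasDerivAt (fun s => ∑ i, ((p - N + 1) * Real.log (1 + x s i)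
        + (q - N + 1) * Real.log (1 - x s i)))
      (∑ i, ((p - N + 1) * (v i / (1 + x t i)) + (q - N + 1) * (-v i / (1 - x t i)))) t := by
    refine HasDerivAt.fun_sum fun i _ => ?_
    obtain ⟨h1, h2⟩ := hx.2 i
    exact ((((hd' i).const_add 1).log (by linarith)).const_mul _).fun_add
      ((((hd' i).const_sub 1).log (by linarith)).const_mul _)
  refine (h1.fun_add h2).congr_deriv ?_
  -- Restoring the diagonal term is harmless because `0⁻¹ = 0`; full double sums can then be
  -- swapped.
  have hfull : ∀ i, ∀ f : Fin N → ℝ, ∑ j ∈ Finset.univ.erase i, f j * (x t i - x t j)⁻¹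
      = ∑ j, f j * (x t i - x t j)⁻¹ := fun i f => Finset.sum_erase _ (by simp)
  have hsym : ∑ i, ∑ j ∈ Finset.univ.erase i, (v i - v j) / (x t i - x t j)
      = ∑ i, v i * (2 * ∑ j ∈ Finset.univ.erase i, (x t i - x t j)⁻¹) := by
    have hswap : ∑ i, ∑ j, v j * (x t i - x t j)⁻¹ = -∑ i, ∑ j, v i * (x t i - x t j)⁻¹ := by
      rw [Finset.sum_comm, ← Finset.sum_neg_distrib]
      refine Finset.sum_congr rfl fun i _ => ?_
      rw [← Finset.sum_neg_distrib]
      refine Finset.sum_congr rfl fun j _ => ?_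
      rw [← mul_neg, ← inv_neg, neg_sub]
    simp only [div_eq_mul_inv]
    rw [Finset.sum_congr rfl fun i _ => hfull i fun j => v i - v j]
    simp only [sub_mul, Finset.sum_sub_distrib, hswap]
    rw [sub_neg_eq_add, ← two_mul, Finset.mul_sum]
    refine Finset.sum_congr rfl fun i _ => ?_
    rw [← hfull i fun _ => v i, ← Finset.mul_sum]
    ring
  rw [hsym, ← Finset.sum_add_distrib]
  refine Finset.sum_congr rfl fun i _ => ?_
  ring

theorem jacobiDensity_le_of_ode {N : ℕ} {p q : ℝ} {x : ℝ → Fin N → ℝ} {a b : ℝ} (hab : a ≤ b)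
    (hx : ∀ t ∈ Icc a b, x t ∈ interior (alcove N))
    (hd : ∀ t ∈ Icc a b, HasDerivAt x (jacobiField p q (x t)) t) :
    jacobiDensity p q (x a) ≤ jacobiDensity p q (x b) := by
  have hmono : MonotoneOn (fun s => jacobiLogDensity p q (x s)) (Icc a b) := by
    have hE := fun t (ht : t ∈ Icc a b) =>
      hasDerivAt_jacobiLogDensity (p := p) (q := q) (hx t ht) (hd t ht)
    refine monotoneOn_of_hasDerivWithinAt_nonneg (convex_Icc a b)
      (fun t ht => (hE t ht).continuousAt.continuousWithinAt)
      (fun t ht => (hE t (interior_subset ht)).hasDerivWithinAt) fun t ht => ?_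
    -- Each summand is (1 - x_i²) times the square of a partial derivative.
    refine Finset.sum_nonneg fun i _ => ?_
    have hxt := hx t (interior_subset ht)
    rw [jacobiField_eq_mul p q hxt]
    rw [interior_alcove] at hxt
    obtain ⟨h1, h2⟩ := hxt.2 i
    rw [mul_assoc]
    exact mul_nonneg (by nlinarith) (mul_self_nonneg _)
  rw [jacobiDensity_eq_exp p q (hx a ⟨le_rfl, hab⟩), jacobiDensity_eq_exp p q (hx b ⟨hab, le_rfl⟩)]
  exact Real.exp_le_exp.mpr (hmono ⟨le_rfl, hab⟩ ⟨hab, le_rfl⟩ hab)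

theorem jacobiDensity_pos {N : ℕ} (p q : ℝ) {x : Fin N → ℝ} (hx : x ∈ interior (alcove N)) :
    0 < jacobiDensity p q x := by
  rw [jacobiDensity_eq_exp p q hx]
  exact Real.exp_pos _

theorem contDiffAt_jacobiField {N : ℕ} (p q : ℝ) {x : Fin N → ℝ} (hx : Function.Injective x) :
    ContDiffAt ℝ 1 (jacobiField p q) x := by
  refine contDiffAt_pi.mpr fun i => ?_
  unfold jacobiField
  refine ContDiffAt.add (by fun_prop) (contDiffAt_const.mul (ContDiffAt.sum fun j hj => ?_))
  refine ContDiffAt.div (by fun_prop) (by fun_prop) (sub_ne_zero.mpr fun h => ?_)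
  exact (Finset.ne_of_mem_erase hj) (hx h).symm

/-! ### Existence by continuation, then by closure -/

/-- The evolution of the coordinates `jacobiModes` along the ODE. -/
def jacobiModeFlow {N : ℕ} {p q : ℝ} (h : -2 < (q - N) + (p - N)) (x₀ : Fin N → ℝ) (t : ℝ)
    (k : ℕ) : ℝ :=
  Real.exp (-jacobiRate N p q k * t) * jacobiModes h x₀ k

section flow

variable {N : ℕ} {p q : ℝ} (h : -2 < (q - N) + (p - N))

theorem jacobiModeFlow_zero (x₀ : Fin N → ℝ) : jacobiModeFlow h x₀ 0 = jacobiModes h x₀ := by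
  ext k; simp [jacobiModeFlow]

theorem jacobiModeFlow_add {x₀ x₁ : Fin N → ℝ} {s : ℝ}
    (hx : jacobiModes h x₁ = jacobiModeFlow h x₀ s) (t : ℝ) :
    jacobiModeFlow h x₁ t = jacobiModeFlow h x₀ (s + t) := by
  ext k
  rw [jacobiModeFlow, hx, jacobiModeFlow, jacobiModeFlow, ← mul_assoc, ← Real.exp_add]
  ring_nf

theorem continuous_jacobiModeFlow (x₀ : Fin N → ℝ) : Continuous (jacobiModeFlow h x₀) := by
  refine continuous_pi fun k => ?_
  unfold jacobiModeFlow
  fun_prop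

theorem continuous_jacobiModeFlow_left (t : ℝ) :
    Continuous fun x₀ : Fin N → ℝ => jacobiModeFlow h x₀ t := by
  refine continuous_pi fun k => ?_
  exact continuous_const.mul ((continuous_apply k).comp (continuous_jacobiModes h))

theorem exists_local_jacobiSolution {x₀ : Fin N → ℝ} (hx : x₀ ∈ interior (alcove N)) (t₀ : ℝ) :
    ∃ y : ℝ → Fin N → ℝ, y t₀ = x₀ ∧ ∃ ε > 0, ∀ t ∈ Ioo (t₀ - ε) (t₀ + ε),
      y t ∈ interior (alcove N) ∧ HasDerivAt y (jacobiField p q (y t)) t ∧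
        jacobiModes h (y t) = jacobiModeFlow h x₀ (t - t₀) := by
  have hmem := hx
  rw [interior_alcove] at hmem
  obtain ⟨y, hy, ε, hε, hd⟩ := (contDiffAt_jacobiField p q
    hmem.1.injective).exists_forall_mem_closedBall_exists_eq_forall_mem_Ioo_hasDerivAt₀ t₀
  have hc : ContinuousAt y t₀ := (hd t₀ ⟨by linarith, by linarith⟩).continuousAt
  obtain ⟨δ, hδ, hball⟩ := Metric.eventually_nhds_iff.mp (hc.eventually
    (isOpen_interior.mem_nhds (hy.symm ▸ hx)))
  have hd' : ∀ t ∈ Ioo (t₀ - min ε δ) (t₀ + min ε δ),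
      HasDerivAt y (jacobiField p q (y t)) t := fun t ht =>
    hd t ⟨by linarith [ht.1, min_le_left ε δ], by linarith [ht.2, min_le_left ε δ]⟩
  have hint : ∀ t ∈ Ioo (t₀ - min ε δ) (t₀ + min ε δ), y t ∈ interior (alcove N) := by
    intro t ht
    refine hball ?_
    rw [Real.dist_eq, abs_lt]
    constructor <;> linarith [ht.1, ht.2, min_le_right ε δ]
  have hinj : ∀ t ∈ Ioo (t₀ - min ε δ) (t₀ + min ε δ), Function.Injective (y t) := by
    intro t ht
    have := hint t ht
    rw [interior_alcove] at this
    exact this.1.injective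
  have hpos : 0 < min ε δ := lt_min hε hδ
  refine ⟨y, hy, min ε δ, hpos, fun t ht => ⟨hint t ht, hd' t ht, ?_⟩⟩
  ext k
  rcases le_total t₀ t with htt | htt
  · have hsub : Icc t₀ t ⊆ Ioo (t₀ - min ε δ) (t₀ + min ε δ) :=
      fun s hs => ⟨by linarith [hs.1], by linarith [hs.2, ht.2]⟩
    rw [jacobiModes_eq_exp_mul h htt (fun s hs => (hd' s (hsub hs)).continuousAt.continuousWithinAt)
      (fun s hs => hinj s (hsub (Ioo_subset_Icc_self hs)))
      (fun s hs => hd' s (hsub (Ioo_subset_Icc_self hs))), hy, jacobiModeFlow]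
  · have hsub : Icc t t₀ ⊆ Ioo (t₀ - min ε δ) (t₀ + min ε δ) :=
      fun s hs => ⟨by linarith [hs.1, ht.1], by linarith [hs.2]⟩
    have := jacobiModes_eq_exp_mul h htt
      (fun s hs => (hd' s (hsub hs)).continuousAt.continuousWithinAt)
      (fun s hs => hinj s (hsub (Ioo_subset_Icc_self hs)))
      (fun s hs => hd' s (hsub (Ioo_subset_Icc_self hs))) k
    rw [hy] at this
    rw [jacobiModeFlow, this, ← mul_assoc, ← Real.exp_add]
    ring_nf
    simp

/-- Continuation without a maximal solution: the times at which the explicit flow is realized in a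
compact superlevel set form a closed set, and a local solution from any such time extends it to the
right. -/
theorem exists_mem_alcove_jacobiDensity_le (hp : (N : ℝ) - 1 < p) (hq : (N : ℝ) - 1 < q)
    {x₀ : Fin N → ℝ} (hx : x₀ ∈ interior (alcove N)) {t : ℝ} (ht : 0 ≤ t) :
    ∃ x ∈ alcove N, jacobiDensity p q x₀ ≤ jacobiDensity p q x ∧
      jacobiModes h x = jacobiModeFlow h x₀ t := by
  set K := alcove N ∩ {x | jacobiDensity p q x₀ ≤ jacobiDensity p q x} with hK
  have hKc : IsCompact K := (isCompact_alcove N).inter_right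
    (isClosed_le continuous_const (continuous_jacobiDensity hp hq))
  set S := jacobiModeFlow h x₀ ⁻¹' (jacobiModes h '' K) with hS
  have hScl : IsClosed S := ((hKc.image (continuous_jacobiModes h)).isClosed).preimage
    (continuous_jacobiModeFlow h x₀)
  have key : Icc 0 t ⊆ S := by
    refine (hScl.inter isClosed_Icc).Icc_subset_of_forall_exists_gt ?_ fun s hs r hr => ?_
    · exact ⟨x₀, ⟨interior_subset hx, le_refl (jacobiDensity p q x₀)⟩, (jacobiModeFlow_zero h x₀).symm⟩
    · obtain ⟨x₁, ⟨hx₁, hF⟩, hm⟩ := hs.1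
      have hx₁' := mem_interior_alcove_of_jacobiDensity_pos hp hq hx₁
        ((jacobiDensity_pos p q hx).trans_le hF)
      obtain ⟨y, hy, ε, hε, hall⟩ := exists_local_jacobiSolution h hx₁' s
      have hr' : s < r := hr
      set u := min r (s + ε / 2) with hu
      have hsu : s < u := lt_min hr' (by linarith)
      have hue : u ≤ s + ε / 2 := min_le_right _ _
      have hsub : Icc s u ⊆ Ioo (s - ε) (s + ε) :=
        fun v hv => ⟨by linarith [hv.1], by linarith [hv.2]⟩
      have huIcc : u ∈ Icc s u := ⟨hsu.le, le_rfl⟩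
      refine ⟨u, ⟨y u, ⟨interior_subset (hall u (hsub huIcc)).1, ?_⟩, ?_⟩, hsu, min_le_left _ _⟩
      · have := jacobiDensity_le_of_ode (p := p) (q := q) hsu.le
          (fun v hv => (hall v (hsub hv)).1) (fun v hv => (hall v (hsub hv)).2.1)
        rw [hy] at this
        exact hF.trans this
      · rw [(hall u (hsub huIcc)).2.2, jacobiModeFlow_add h hm]
        ring_nf
  obtain ⟨x, ⟨hxA, hxF⟩, hxm⟩ := key ⟨ht, le_rfl⟩
  exact ⟨x, hxA, hxF, hxm⟩

/-- For fixed `t` the admissible starts form a closed set, as the image of the compact alcove is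
closed; it contains the dense interior. -/
theorem exists_mem_alcove_jacobiModes_eq (hp : (N : ℝ) - 1 < p) (hq : (N : ℝ) - 1 < q)
    {x₀ : Fin N → ℝ} (hx : x₀ ∈ alcove N) {t : ℝ} (ht : 0 ≤ t) :
    ∃ x ∈ alcove N, jacobiModes h x = jacobiModeFlow h x₀ t := by
  have hcl : IsClosed {x₀ : Fin N → ℝ | jacobiModeFlow h x₀ t ∈ jacobiModes h '' alcove N} :=
    (((isCompact_alcove N).image (continuous_jacobiModes h)).isClosed).preimage
      (continuous_jacobiModeFlow_left h t)
  have hsub : interior (alcove N)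
      ⊆ {x₀ : Fin N → ℝ | jacobiModeFlow h x₀ t ∈ jacobiModes h '' alcove N} := by
    intro y hy
    obtain ⟨x, hxA, -, hxm⟩ := exists_mem_alcove_jacobiDensity_le h hp hq hy ht
    exact ⟨x, hxA, hxm⟩
  rw [← closure_interior_alcove] at hx
  exact closure_minimal hsub hcl hx

/-- A continuous injection on a compact set has a continuous inverse on its image. -/
theorem tendsto_of_tendsto_jacobiModes {ι : Type*} {l : Filter ι} {f : ι → Fin N → ℝ}
    {z : Fin N → ℝ} (hz : z ∈ alcove N) (hf : ∀ᶠ i in l, f i ∈ alcove N)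
    (hm : Tendsto (fun i => jacobiModes h (f i)) l (𝓝 (jacobiModes h z))) :
    Tendsto f l (𝓝 z) := by
  refine (isCompact_alcove N).tendsto_nhds_of_unique_mapClusterPt hf fun y hy hcl => ?_
  refine jacobiModes_injOn h hy.1 hz.1 ?_
  have hcl' : MapClusterPt (jacobiModes h y) l (jacobiModes h ∘ f) :=
    hcl.continuousAt_comp (continuous_jacobiModes h).continuousAt
  exact eq_of_nhds_neBot (hcl'.clusterPt.mono hm)

/-! ### Curves with prescribed coordinates -/

/-- A curve in the alcove whose coordinates `jacobiModes` evolve as along the ODE. -/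
def IsJacobiModePath (x₀ : Fin N → ℝ) (x : ℝ → Fin N → ℝ) : Prop :=
  ∀ t, 0 ≤ t → x t ∈ alcove N ∧ jacobiModes h (x t) = jacobiModeFlow h x₀ t

theorem exists_isJacobiModePath (hp : (N : ℝ) - 1 < p) (hq : (N : ℝ) - 1 < q)
    {x₀ : Fin N → ℝ} (hx : x₀ ∈ alcove N) : ∃ x, IsJacobiModePath h x₀ x := by
  choose! x hx using fun (t : ℝ) (ht : 0 ≤ t) => exists_mem_alcove_jacobiModes_eq h hp hq hx ht
  exact ⟨x, hx⟩

variable {h}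

namespace IsJacobiModePath

variable {x₀ : Fin N → ℝ} {x : ℝ → Fin N → ℝ}

theorem eq_of_jacobiModes_eq (hx : IsJacobiModePath h x₀ x) {t : ℝ} (ht : 0 ≤ t) {y : Fin N → ℝ}
    (hy : Monotone y) (hm : jacobiModes h y = jacobiModeFlow h x₀ t) : x t = y :=
  jacobiModes_injOn h (hx t ht).1.1 hy ((hx t ht).2.trans hm.symm)

theorem apply_zero (hx : IsJacobiModePath h x₀ x) (hx₀ : x₀ ∈ alcove N) : x 0 = x₀ :=
  hx.eq_of_jacobiModes_eq le_rfl hx₀.1 (jacobiModeFlow_zero h x₀).symm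

theorem continuousOn (hx : IsJacobiModePath h x₀ x) : ContinuousOn x (Ici 0) := by
  intro t ht
  refine tendsto_of_tendsto_jacobiModes h (hx t ht).1
    (eventually_mem_nhdsWithin.mono fun s hs => (hx s hs).1) ?_
  rw [(hx t ht).2]
  refine ((continuous_jacobiModeFlow h x₀).continuousWithinAt (s := Ici 0)).congr' ?_
  exact eventually_mem_nhdsWithin.mono fun s hs => (hx s hs).2.symm

/-- By injectivity the curve coincides with the local ODE solution through `x t`. Restricting to
`Ici 0` covers t = 0 as well. -/
theorem hasDerivWithinAt (hx : IsJacobiModePath h x₀ x) {t : ℝ} (ht : 0 ≤ t)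
    (hint : x t ∈ interior (alcove N)) :
    HasDerivWithinAt x (jacobiField p q (x t)) (Ici 0) t := by
  obtain ⟨y, hy, ε, hε, hall⟩ := exists_local_jacobiSolution h hint t
  have hty : t ∈ Ioo (t - ε) (t + ε) := ⟨by linarith, by linarith⟩
  have hd := (hall t hty).2.1.hasDerivWithinAt (s := Ici 0)
  rw [hy] at hd
  refine hd.congr_of_eventuallyEq ?_ hy.symm
  filter_upwards [self_mem_nhdsWithin, mem_nhdsWithin_of_mem_nhds (Ioo_mem_nhds hty.1 hty.2)]
    with s hs hs'
  refine hx.eq_of_jacobiModes_eq hs (interior_subset (hall s hs').1).1 ?_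
  rw [(hall s hs').2.2, jacobiModeFlow_add h (hx t ht).2]
  ring_nf

theorem jacobiDensity_le (hp : (N : ℝ) - 1 < p) (hq : (N : ℝ) - 1 < q)
    (hx : IsJacobiModePath h x₀ x) {s t : ℝ} (hs : 0 ≤ s) (hst : s ≤ t)
    (hint : x s ∈ interior (alcove N)) : jacobiDensity p q (x s) ≤ jacobiDensity p q (x t) := by
  obtain ⟨y, hyA, hyF, hym⟩ :=
    exists_mem_alcove_jacobiDensity_le h hp hq hint (sub_nonneg.mpr hst)
  rw [jacobiModeFlow_add h (hx s hs).2, add_sub_cancel] at hym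
  rwa [hx.eq_of_jacobiModes_eq (hs.trans hst) hyA.1 hym]

theorem mem_interior (hp : (N : ℝ) - 1 < p) (hq : (N : ℝ) - 1 < q)
    (hx : IsJacobiModePath h x₀ x) {s t : ℝ} (hs : 0 ≤ s) (hst : s ≤ t)
    (hint : x s ∈ interior (alcove N)) : x t ∈ interior (alcove N) :=
  mem_interior_alcove_of_jacobiDensity_pos hp hq (hx t (hs.trans hst)).1
    ((jacobiDensity_pos p q hint).trans_le (hx.jacobiDensity_le hp hq hs hst hint))

end IsJacobiModePath

variable (h)

/-! ### Long-time limit and the zeros of the Jacobi polynomial -/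

theorem tendsto_jacobiModeFlow (hp : (N : ℝ) - 1 < p) (hq : (N : ℝ) - 1 < q) (x₀ : Fin N → ℝ) :
    Tendsto (jacobiModeFlow h x₀) atTop (𝓝 (Pi.single N (jacobiModes h x₀ N))) := by
  refine tendsto_pi_nhds.mpr fun k => ?_
  unfold jacobiModeFlow
  rcases lt_trichotomy k N with hk | hk | hk
  · rw [Pi.single_eq_of_ne hk.ne, ← zero_mul (jacobiModes h x₀ k)]
    refine Tendsto.mul_const _ (Real.tendsto_exp_atBot.comp ?_)
    have hk' : (k : ℝ) + 1 ≤ N := by exact_mod_cast hk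
    have hk0 : (0 : ℝ) ≤ k := k.cast_nonneg
    have hμ : 0 < jacobiRate N p q k := mul_pos (by linarith) (by linarith)
    exact tendsto_id.const_mul_atTop_of_neg (neg_lt_zero.mpr hμ)
  · subst hk
    simp [jacobiRate]
  · rw [Pi.single_eq_of_ne hk.ne']
    simp [jacobiModes_eq_zero h x₀ hk]

theorem roots_jacobiPoly_of_jacobiModes_eq_single {z : Fin N → ℝ} {c : ℝ}
    (hz : jacobiModes h z = Pi.single N c) :
    (jacobiPoly N (q - N) (p - N)).roots = Finset.univ.val.map z := by
  have hrepr : (jacobiBasis h).repr (rootPoly z) = Finsupp.single N c := by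
    ext k
    rw [Finsupp.single_apply]
    have := congrFun hz k
    rw [Pi.single_apply] at this
    simpa [eq_comm, jacobiModes] using this
  have hpoly : rootPoly z = C c * jacobiPoly N (q - N) (p - N) := by
    apply (jacobiBasis h).repr.injective
    rw [hrepr, ← smul_eq_C_mul, ← jacobiBasis_apply h, map_smul, Module.Basis.repr_self]
    simp
  have hc : c ≠ 0 := by
    rintro rfl
    exact (rootPoly_monic z).ne_zero (by simpa using hpoly)
  rw [← rootPoly_roots, hpoly, roots_C_mul _ hc]

theorem exists_jacobiZeros (hp : (N : ℝ) - 1 < p) (hq : (N : ℝ) - 1 < q) :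
    ∃ z ∈ interior (alcove N), (jacobiPoly N (q - N) (p - N)).roots = Finset.univ.val.map z ∧
      (∃ c, jacobiModes h z = Pi.single N c) ∧
      ∀ x₀ x, IsJacobiModePath h x₀ x → Tendsto x atTop (𝓝 z) := by
  -- The compact set is left free: a superlevel set places z in the interior, and the whole alcove
  -- handles arbitrary starts.
  have hlim : ∀ x₀ x (K : Set (Fin N → ℝ)), IsJacobiModePath h x₀ x → IsCompact K →
      (∀ t, 0 ≤ t → x t ∈ K) → ∃ z ∈ K, jacobiModes h z = Pi.single N (jacobiModes h x₀ N) := by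
    intro x₀ x K hx hK hxK
    refine (hK.image (continuous_jacobiModes h)).isClosed.mem_of_tendsto
      (tendsto_jacobiModeFlow h hp hq x₀) ?_
    filter_upwards [eventually_ge_atTop 0] with t ht
    exact ⟨x t, hxK t ht, (hx t ht).2⟩
  obtain ⟨x₀, hx₀⟩ := interior_alcove_nonempty N
  obtain ⟨x, hx⟩ := exists_isJacobiModePath h hp hq (interior_subset hx₀)
  obtain ⟨z, ⟨hzA, hzF⟩, hzm⟩ := hlim x₀ x
    (alcove N ∩ {y | jacobiDensity p q x₀ ≤ jacobiDensity p q y}) hx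
    ((isCompact_alcove N).inter_right (isClosed_le continuous_const
      (continuous_jacobiDensity hp hq)))
    fun t ht => by
      have hx0 := hx.apply_zero (interior_subset hx₀)
      refine ⟨(hx t ht).1, ?_⟩
      have := hx.jacobiDensity_le hp hq le_rfl ht (hx0.symm ▸ hx₀)
      rwa [hx0] at this
  have hzroots := roots_jacobiPoly_of_jacobiModes_eq_single h hzm
  refine ⟨z, mem_interior_alcove_of_jacobiDensity_pos hp hq hzA
    ((jacobiDensity_pos p q hx₀).trans_le hzF), hzroots, ⟨_, hzm⟩, fun y₀ y hy => ?_⟩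
  obtain ⟨w, hwA, hwm⟩ := hlim y₀ y (alcove N) hy (isCompact_alcove N) fun t ht => (hy t ht).1
  -- Both limits list the roots of the same Jacobi polynomial in increasing order, so the limit does
  -- not depend on the start.
  have hwz : w = z := eq_of_monotone_of_multiset_map_eq hwA.1 hzA.1
    ((roots_jacobiPoly_of_jacobiModes_eq_single h hwm).symm.trans hzroots)
  subst hwz
  refine tendsto_of_tendsto_jacobiModes h hwA
    ((eventually_ge_atTop 0).mono fun t ht => (hy t ht).1) ?_
  rw [hwm]
  exact (tendsto_jacobiModeFlow h hp hq y₀).congr'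
    ((eventually_ge_atTop 0).mono fun t ht => (hy t ht).2.symm)

end flow

/-! ### Immediate entrance into the interior -/

/-- The square of the Vandermonde product, up to sign, times `∏ (1 - x_i ^ 2)`: a symmetric
polynomial that vanishes on the boundary of the alcove. -/
def alcoveDiscr (N : ℕ) : MvPolynomial (Fin N) ℝ :=
  (∏ x ∈ (Finset.univ : Finset (Fin N)).offDiag, (MvPolynomial.X x.1 - MvPolynomial.X x.2))
    * ∏ i, (1 - MvPolynomial.X i ^ 2)

theorem alcoveDiscr_isSymmetric (N : ℕ) : (alcoveDiscr N).IsSymmetric := by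
  intro e
  simp only [alcoveDiscr, map_mul, map_prod, map_sub, map_pow, map_one, MvPolynomial.rename_X]
  congr 1
  · exact Finset.prod_equiv (e.prodCongr e) (by simp) (by simp)
  · exact Equiv.prod_comp e fun i => (1 - MvPolynomial.X i ^ 2 : MvPolynomial (Fin N) ℝ)

theorem eval_alcoveDiscr {N : ℕ} (x : Fin N → ℝ) :
    MvPolynomial.eval x (alcoveDiscr N)
      = (∏ y ∈ (Finset.univ : Finset (Fin N)).offDiag, (x y.1 - x y.2)) * ∏ i, (1 - x i ^ 2) := by
  simp [alcoveDiscr]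

theorem eval_alcoveDiscr_ne_zero {N : ℕ} {x : Fin N → ℝ} (hx : x ∈ alcove N) :
    MvPolynomial.eval x (alcoveDiscr N) ≠ 0 ↔ x ∈ interior (alcove N) := by
  rw [eval_alcoveDiscr, interior_alcove]
  simp only [ne_eq, mul_eq_zero, not_or, Finset.prod_eq_zero_iff, not_exists, not_and,
    Finset.mem_offDiag, Finset.mem_univ, true_and, Prod.forall, sub_eq_zero]
  constructor
  · rintro ⟨h1, h2⟩
    refine ⟨hx.1.strictMono_of_injective fun i j hij => by_contra fun hne => h1 i j hne hij,
      fun i => ?_⟩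
    obtain ⟨h3, h4⟩ := hx.2 i
    exact ⟨lt_of_le_of_ne h3 fun h => h2 i (by rw [← h]; norm_num),
      lt_of_le_of_ne h4 fun h => h2 i (by rw [h]; norm_num)⟩
  · rintro ⟨h1, h2⟩
    refine ⟨fun i j hne hij => hne (h1.injective hij), fun i => ?_⟩
    obtain ⟨h3, h4⟩ := h2 i
    exact (by nlinarith : x i ^ 2 < 1).ne'

/-- The fundamental theorem on symmetric polynomials; by Vieta the elementary ones are signed
coefficients of the root polynomial. -/
theorem exists_eval_eq_of_isSymmetric {N : ℕ} {f : MvPolynomial (Fin N) ℝ} (hf : f.IsSymmetric) :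
    ∃ g : MvPolynomial (Fin N) ℝ, ∀ x : Fin N → ℝ, MvPolynomial.eval x f
      = MvPolynomial.eval
        (fun i : Fin N => (-1) ^ ((i : ℕ) + 1) * (rootPoly x).coeff (N - (i + 1))) g := by
  obtain ⟨g, hg⟩ := MvPolynomial.esymmAlgHom_fin_surjective ℝ le_rfl ⟨f, hf⟩
  refine ⟨g, fun x => ?_⟩
  have hg' : MvPolynomial.aeval (fun i : Fin N => MvPolynomial.esymm (Fin N) ℝ (i + 1)) g = f := by
    rw [← MvPolynomial.esymmAlgHom_apply, hg]
  rw [← hg', ← MvPolynomial.coe_aeval_eq_eval, ← MvPolynomial.coe_aeval_eq_eval]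
  simp only [RingHom.coe_coe]
  rw [← AlgHom.comp_apply, MvPolynomial.comp_aeval]
  congr 2
  ext i
  have hc := Multiset.prod_X_sub_C_coeff (Finset.univ.val.map x) (k := N - (i + 1))
    (by simp)
  have hN : N - (N - ((i : ℕ) + 1)) = i + 1 := by omega
  simp only [Multiset.map_map, Multiset.card_map, Finset.card_val, Finset.card_univ,
    Fintype.card_fin, hN] at hc
  have hr : (rootPoly x).coeff (N - (i + 1)) = _ := hc
  rw [MvPolynomial.aeval_esymm_eq_multiset_esymm, hr, ← mul_assoc, ← pow_add, ← two_mul, pow_mul]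
  simp

section

variable {N : ℕ} {p q : ℝ} {h : -2 < (q - N) + (p - N)}

theorem rootPoly_eq_sum_jacobiModes (x : Fin N → ℝ) :
    rootPoly x = ∑ k ∈ Finset.range (N + 1),
      C (jacobiModes h x k) * jacobiPoly k (q - N) (p - N) := by
  conv_lhs => rw [← (jacobiBasis h).linearCombination_repr (rootPoly x),
    Finsupp.linearCombination_apply]
  rw [Finsupp.sum_of_support_subset (s := Finset.range (N + 1))]
  · simp [jacobiBasis_apply, jacobiModes, smul_eq_C_mul]
  · intro k hk
    rw [Finset.mem_range, Nat.lt_succ_iff]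
    by_contra hlt
    exact (Finsupp.mem_support_iff.mp hk) (jacobiModes_eq_zero h x (not_le.mp hlt))
  · simp

namespace IsJacobiModePath

variable {x₀ : Fin N → ℝ} {x : ℝ → Fin N → ℝ}

/-- The coefficients of the root polynomial are finite combinations of exponentials in t. -/
theorem exists_analytic_eval_eq (hx : IsJacobiModePath h x₀ x) {f : MvPolynomial (Fin N) ℝ}
    (hf : f.IsSymmetric) :
    ∃ d : ℝ → ℝ, AnalyticOnNhd ℝ d univ ∧ ∀ t, 0 ≤ t → MvPolynomial.eval (x t) f = d t := by
  obtain ⟨g, hg⟩ := exists_eval_eq_of_isSymmetric hf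
  set e : ℝ → Fin N → ℝ := fun t i => (-1) ^ ((i : ℕ) + 1) * ∑ k ∈ Finset.range (N + 1),
    jacobiModeFlow h x₀ t k * (jacobiPoly k (q - N) (p - N)).coeff (N - (i + 1)) with he
  have hea : ∀ i, AnalyticOnNhd ℝ (fun t => e t i) univ := by
    intro i t _
    refine analyticAt_const.mul (Finset.analyticAt_fun_sum _ fun k _ => ?_)
    unfold jacobiModeFlow
    fun_prop
  refine ⟨fun t => MvPolynomial.eval (e t) g, ?_, fun t ht => ?_⟩
  · exact AnalyticOnNhd.aeval_mvPolynomial (A := ℝ) hea g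
  · rw [hg, rootPoly_eq_sum_jacobiModes (h := h), (hx t ht).2]
    simp [he]

theorem mem_interior_of_pos (hp : (N : ℝ) - 1 < p) (hq : (N : ℝ) - 1 < q)
    (hx : IsJacobiModePath h x₀ x) {t : ℝ} (ht : 0 < t) : x t ∈ interior (alcove N) := by
  by_contra hnot
  obtain ⟨d, hda, hd⟩ := hx.exists_analytic_eval_eq (alcoveDiscr_isSymmetric N)
  -- The interior cannot be left, so a boundary point at time t forces boundary points at all
  -- earlier times.
  have hzero : ∀ s, 0 ≤ s → s ≤ t → d s = 0 := by
    intro s hs hst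
    by_contra hne
    rw [← hd s hs] at hne
    exact hnot (hx.mem_interior hp hq hs hst ((eval_alcoveDiscr_ne_zero (hx s hs).1).mp hne))
  have hev : d =ᶠ[𝓝 (t / 2)] 0 := by
    filter_upwards [Ioo_mem_nhds (half_pos ht) (half_lt_self ht)] with s hs
    exact hzero s hs.1.le hs.2.le
  have hall := hda.eqOn_zero_of_preconnected_of_eventuallyEq_zero isPreconnected_univ
    (mem_univ (t / 2)) hev
  obtain ⟨z, hz, -, -, hlim⟩ := exists_jacobiZeros h hp hq
  refine (eval_alcoveDiscr_ne_zero (interior_subset hz)).mpr hz ?_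
  have hc : Tendsto (fun s => MvPolynomial.eval (x s) (alcoveDiscr N)) atTop
      (𝓝 (MvPolynomial.eval z (alcoveDiscr N))) :=
    ((MvPolynomial.continuous_eval _).tendsto z).comp (hlim x₀ x hx)
  refine tendsto_nhds_unique hc (tendsto_const_nhds.congr' ?_)
  filter_upwards [eventually_ge_atTop 0] with s hs
  rw [hd s hs]
  exact (hall (mem_univ s)).symm

theorem isJacobiSolution (hp : (N : ℝ) - 1 < p) (hq : (N : ℝ) - 1 < q)
    (hx : IsJacobiModePath h x₀ x) (hx₀ : x₀ ∈ alcove N) : IsJacobiSolution p q x₀ x where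
  continuousOn := hx.continuousOn
  start := hx.apply_zero hx₀
  distinct t ht := by
    have := hx.mem_interior_of_pos hp hq ht
    rw [interior_alcove] at this
    exact this.1.injective
  ode t ht :=
    (hx.hasDerivWithinAt ht.le (hx.mem_interior_of_pos hp hq ht)).hasDerivAt (Ici_mem_nhds ht)

end IsJacobiModePath

/-! ### Uniqueness and conclusion -/

theorem IsJacobiSolution.jacobiModes_eq {x₀ : Fin N → ℝ} {y : ℝ → Fin N → ℝ}
    (h : -2 < (q - N) + (p - N)) (hy : IsJacobiSolution p q x₀ y) {t : ℝ} (ht : 0 ≤ t) :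
    jacobiModes h (y t) = jacobiModeFlow h x₀ t := by
  ext k
  rw [jacobiModes_eq_exp_mul h ht (hy.continuousOn.mono fun s hs => mem_Ici.mpr hs.1)
    (fun s hs => hy.distinct s hs.1) (fun s hs => hy.ode s hs.1), hy.start, sub_zero,
    jacobiModeFlow]

/-- Continuous coordinates that never meet keep their order. Hence uniqueness from an interior start
needs no assumption that the solution stays in the alcove. -/
theorem IsJacobiSolution.strictMono {x₀ : Fin N → ℝ} {y : ℝ → Fin N → ℝ}
    (hy : IsJacobiSolution p q x₀ y) (hx₀ : StrictMono x₀) {t : ℝ} (ht : 0 ≤ t) :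
    StrictMono (y t) := by
  intro i j hij
  have hinj : ∀ s, 0 ≤ s → y s i ≠ y s j := by
    intro s hs heq
    rcases hs.eq_or_lt with rfl | hs
    · rw [hy.start] at heq
      exact (hx₀ hij).ne heq
    · exact hij.ne (hy.distinct s hs heq)
  by_contra hlt
  have hc : ContinuousOn (fun s => y s j - y s i) (Icc 0 t) := by
    have := hy.continuousOn.mono fun s (hs : s ∈ Icc 0 t) => mem_Ici.mpr hs.1
    exact ((continuous_apply j).comp_continuousOn this).sub
      ((continuous_apply i).comp_continuousOn this)
  have h0 : (0 : ℝ) ∈ Icc (y t j - y t i) (y 0 j - y 0 i) := by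
    rw [hy.start]
    exact ⟨by linarith, (sub_pos.mpr (hx₀ hij)).le⟩
  obtain ⟨s, hs, hs0⟩ := intermediate_value_Icc' ht hc h0
  exact hinj s hs.1 (sub_eq_zero.mp hs0).symm

end

end

theorem mainTheorem5 (N : ℕ) (hN : 1 ≤ N) (p q : ℝ) (hp : (N : ℝ) - 1 < p)
    (hq : (N : ℝ) - 1 < q) :
    ∃ z : Fin N → ℝ,
      -- `z` lies in the interior and is the increasing vector of all zeros (with multiplicity)
      (z ∈ interior (alcove N) ∧ StrictMono z ∧
        (jacobiPoly N (q - N) (p - N)).roots = Finset.univ.val.map z) ∧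
      -- start in the interior
      (∀ x₀ ∈ interior (alcove N), ∃ x : ℝ → Fin N → ℝ,
        IsJacobiSolution p q x₀ x ∧
        HasDerivWithinAt x (jacobiField p q x₀) (Ici 0) 0 ∧
        (∀ t, 0 ≤ t → x t ∈ interior (alcove N)) ∧
        Tendsto x atTop (𝓝 z) ∧
        ∀ y : ℝ → Fin N → ℝ, IsJacobiSolution p q x₀ y → EqOn y x (Ici 0)) ∧
      -- start on the boundary
      (∀ x₀ ∈ frontier (alcove N), ∃ x : ℝ → Fin N → ℝ,
        IsJacobiSolution p q x₀ x ∧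
        (∀ t, 0 ≤ t → x t ∈ alcove N) ∧
        (∀ t, 0 < t → x t ∈ interior (alcove N)) ∧
        Tendsto x atTop (𝓝 z) ∧
        ∀ y : ℝ → Fin N → ℝ, IsJacobiSolution p q x₀ y → (∀ t, 0 ≤ t → y t ∈ alcove N) →
          EqOn y x (Ici 0)) ∧
      -- `z` is the only stationary solution in the alcove
      (∀ w ∈ alcove N, IsJacobiSolution p q w (fun _ => w) ↔ w = z) := by
  have h : -2 < (q - N) + (p - N) := by linarith
  obtain ⟨z, hz, hroots, ⟨c, hzm⟩, hlim⟩ := exists_jacobiZeros h hp hq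
  have hzmono : StrictMono z := by
    rw [interior_alcove] at hz
    exact hz.1
  refine ⟨z, ⟨hz, hzmono, hroots⟩, fun x₀ hx₀ => ?_, fun x₀ hx₀ => ?_, fun w hw => ⟨fun hsol => ?_,
    ?_⟩⟩
  · obtain ⟨x, hx⟩ := exists_isJacobiModePath h hp hq (interior_subset hx₀)
    have hx0 := hx.apply_zero (interior_subset hx₀)
    have hmono : StrictMono x₀ := by
      rw [interior_alcove] at hx₀
      exact hx₀.1
    refine ⟨x, hx.isJacobiSolution hp hq (interior_subset hx₀), ?_,
      fun t ht => hx.mem_interior hp hq le_rfl ht (hx0.symm ▸ hx₀), hlim x₀ x hx,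
      fun y hy t ht => ?_⟩
    · have := hx.hasDerivWithinAt le_rfl (hx0.symm ▸ hx₀)
      rwa [hx0] at this
    · exact (hx.eq_of_jacobiModes_eq ht (hy.strictMono hmono ht).monotone
        (hy.jacobiModes_eq h ht)).symm
  · have hA : x₀ ∈ alcove N := (isClosed_alcove N).frontier_subset hx₀
    obtain ⟨x, hx⟩ := exists_isJacobiModePath h hp hq hA
    exact ⟨x, hx.isJacobiSolution hp hq hA, fun t ht => (hx t ht).1,
      fun t ht => hx.mem_interior_of_pos hp hq ht, hlim x₀ x hx, fun y hy hyA t ht =>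
      (hx.eq_of_jacobiModes_eq ht (hyA t ht).1 (hy.jacobiModes_eq h ht)).symm⟩
  · have hpath : IsJacobiModePath h w fun _ => w := fun t ht => ⟨hw, hsol.jacobiModes_eq h ht⟩
    exact tendsto_nhds_unique tendsto_const_nhds (hlim w _ hpath)
  · rintro rfl
    have hpath : IsJacobiModePath h w fun _ => w := by
      refine fun t _ => ⟨hw, funext fun k => ?_⟩
      -- Only the N-th coordinate of z is nonzero, and its rate is 0.
      rw [jacobiModeFlow, hzm, Pi.single_apply]
      split_ifs with hk
      · simp [hk, jacobiRate]
      · simp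
    exact hpath.isJacobiSolution hp hq hw
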